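/- For $n\ge 1$ let $\mathcal T_n$ be the full transformation monoid, i.e. the monoid of all mappings $\{1,\dots,n\}\to\{1,\dots,n\}$, with mappings written to the right of their arguments and composed from left to right: $x(\alpha\beta)=(x\alpha)\beta$. A left congruence of a semigroup $S$ is an equivalence relation $\sigma$ on $S$ such that $(x,y)\in\sigma$ implies $(ax,ay)\in\sigma$ for all $a,x,y\in S$; the left congruences of $S$ form a lattice $\mathsf{LCong}(S)$ under inclusion. Write $\mathrm{Sub}(G)$ for the lattice of subgroups of a group $G$, ordered by inclusion, $\mathcal S_r$ for the symmetric group of degree $r$, and $\mathrm{Ht}(P)$ for the height of a poset $P$, that is, the supremum of the cardinalities of the chains in $P$. Then for every $n\ge 1$, $$\mathrm{Ht}(\mathsf{LCong}(\mathcal T_n))=\sum_{r=1}^{n}\binom{n}{r}\,\mathrm{Ht}(\mathrm{Sub}(\mathcal S_r)).$$ -/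

import Mathlib

/-- The height of a poset `P`: the supremum of the cardinalities of chains in `P`,
as an extended natural number. -/
noncomputable def posetHeight (P : Type*) [PartialOrder P] : ℕ∞ :=
  (Set.univ : Set P).chainHeight (fun x y => x ≤ y)

/-- A left congruence on a semigroup `S`: an equivalence relation compatible with left
multiplication. -/
@[ext]
structure LeftCongruence (S : Type*) [Semigroup S] extends Setoid S where
  mul_left : ∀ a x y : S, toSetoid x y → toSetoid (a * x) (a * y)

namespace LeftCongruence

theorem toSetoid_injective {S : Type*} [Semigroup S] :
    Function.Injective (LeftCongruence.toSetoid : LeftCongruence S → Setoid S) := by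
  rintro ⟨σ, _⟩ ⟨τ, _⟩ h
  cases h
  rfl

/-- Left congruences are ordered by inclusion: `σ ≤ τ` means that `σ x y` implies `τ x y`. -/
instance instPartialOrder {S : Type*} [Semigroup S] : PartialOrder (LeftCongruence S) where
  le σ τ := ∀ x y : S, σ.toSetoid x y → τ.toSetoid x y
  le_refl _ _ _ h := h
  le_trans _ _ _ h₁ h₂ x y h := h₂ x y (h₁ x y h)
  le_antisymm _ _ h₁ h₂ :=
    toSetoid_injective (le_antisymm (fun {x y} h => h₁ x y h) (fun {x y} h => h₂ x y h))

/-- The intersection of a family of left congruences. -/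
instance instInfSet {S : Type*} [Semigroup S] : InfSet (LeftCongruence S) where
  sInf A :=
    { r := fun x y => ∀ σ ∈ A, σ.toSetoid x y
      iseqv :=
        { refl := fun x σ _ => σ.toSetoid.refl' x
          symm := fun h σ hσ => σ.toSetoid.symm' (h σ hσ)
          trans := fun h₁ h₂ σ hσ => σ.toSetoid.trans' (h₁ σ hσ) (h₂ σ hσ) }
      mul_left := fun a x y h σ hσ => σ.mul_left a x y (h σ hσ) }

/-- The left congruences of a semigroup form a (complete) lattice under inclusion. -/
instance instCompleteLattice {S : Type*} [Semigroup S] : CompleteLattice (LeftCongruence S) :=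
  completeLatticeOfInf (LeftCongruence S) fun _ =>
    ⟨fun _ hσ _ _ h => h _ hσ, fun _ hτ x y h σ hσ => hτ hσ x y h⟩

end LeftCongruence

/-- The full transformation monoid `T_n` of all maps from an `n`-element set to itself, acting
on the right: in a product `α * β` the map `α` is applied first. -/
abbrev FullTransformationMonoid (n : ℕ) : Type := (Function.End (Fin n))ᵐᵒᵖ

/-- Products in `T_n` are composed from left to right: `x(αβ) = (xα)β`. -/
theorem FullTransformationMonoid.mul_apply (n : ℕ) (α β : FullTransformationMonoid n)
    (x : Fin n) : (α * β).unop x = β.unop (α.unop x) := rfl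

/-!
Multiplying a transformation on the left amounts to precomposing it, so left multiplication can
only shrink images, and transformations with equal images generate the same left ideal. The
subsets of `Fin n` are ordered colexicographically, which extends inclusion. To a left congruence
`ρ` and a nonempty subset `A` are attached two invariants, increasing in `ρ`:

* whether `ρ` collapses `A`, that is, relates some (equivalently, every) transformation with
  image `A` to one with an earlier image (`LeftCongruence.Collapses`);
* the subgroup of those permutations of `A` by which transformations with image `A` may be
  changed within their `ρ`-class (`LeftCongruence.stab`).

Upper bound: comparable left congruences with the same invariants are equal
(`LeftCongruence.le_of_invariants`), and the subgroup matters only while `A` is not collapsed.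
The main point is that `ρ` collapses `A` as soon as it relates two transformations with image `A`
and different kernels, because some left multiplication fixes one of them and shrinks the image
of the other (`FullTransformationMonoid.exists_ofPerm_or_exists_im_ssubset`). Along a strictly
increasing chain, each `A` therefore accounts for at most as many steps as the height of the
subgroup lattice of the symmetric group on `A`, the last one being the collapse; the least nonempty
subset `{0}` accounts for none.

Lower bound: for `A ≠ {0}` and a subgroup `H` of the symmetric group on `A`, let
`LeftCongruence.layer A H` identify all transformations with images before `A`, and those with
image `A` that differ by an element of `H`. When `A` runs through the subsets in order and `H`
through a longest chain of subgroups, these congruences, followed by the universal one, form a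
chain of the required size.

Both bounds equal one plus the sum of the heights for nonempty `A ≠ {0}`. The extra one is the
height for `{0}`, and grouping the subsets by cardinality gives the binomial coefficients.
-/

/-! ### Heights of posets -/

section PosetHeight

variable {P Q : Type*} [PartialOrder P] [PartialOrder Q]

theorem posetHeight_congr (e : P ≃o Q) : posetHeight P = posetHeight Q := by
  have h := Set.chainHeight_eq_of_relIso (Set.univ : Set P)
    (r := fun x y => x ≤ y) (r' := fun x y : Q => x ≤ y) e
  rw [posetHeight, posetHeight, ← h]
  congr 1
  exact Set.image_univ_of_surjective e.surjective

theorem coe_toNat_posetHeight [Finite P] : ((posetHeight P).toNat : ℕ∞) = posetHeight P :=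
  ENat.natCast_toNat (Set.chainHeight_ne_top_of_finite _ _ Set.finite_univ)

theorem posetHeight_of_unique [Unique P] : posetHeight P = 1 := by
  have h : IsChain (fun x y : P => x ≤ y) Set.univ := Set.subsingleton_univ.isChain
  rw [posetHeight, ← Set.encard_eq_chainHeight_of_isChain _ h]
  simp

/-- A strictly increasing function is injective on chains. -/
theorem posetHeight_le_of_strictMono {φ : P → ℕ} (hφ : StrictMono φ) {N : ℕ}
    (hN : ∀ x, φ x ≤ N) : posetHeight P ≤ N + 1 := by
  refine iSup_le fun ⟨C, _, hC⟩ => ?_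
  have hinj : Set.InjOn φ C := by
    intro x hx y hy hxy
    by_contra hne
    rcases hC hx hy hne with h | h
    · exact (hφ (lt_of_le_of_ne h hne)).ne hxy
    · exact (hφ (lt_of_le_of_ne h (Ne.symm hne))).ne' hxy
  calc C.encard = (φ '' C).encard := hinj.encard_image.symm
    _ ≤ (Set.Iic N).encard := Set.encard_le_encard (by rintro _ ⟨x, _, rfl⟩; exact hN x)
    _ = N + 1 := by
      rw [← Finset.coe_Iic, Set.encard_coe_eq_coe_finsetCard]
      simp

/-- A finite poset has a strictly increasing rank function with fewer values than its height:
send `x` to the height of the set of elements strictly below `x`. -/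
theorem exists_strictMono_lt_posetHeight (P : Type*) [PartialOrder P] [Finite P] :
    ∃ d : P → ℕ, StrictMono d ∧ ∀ x, d x < (posetHeight P).toNat := by
  have key : ∀ (x : P) (s : Set P), (∀ y, y ≤ x → y ∈ s) →
      ((Set.Iio x).chainHeight (fun x y => x ≤ y)).toNat <
        (s.chainHeight (fun x y => x ≤ y)).toNat := by
    intro x s hs
    obtain ⟨t, ht, htc, hchain⟩ := Set.exists_eq_chainHeight_of_finite (Set.Iio x)
      (fun x y => x ≤ y) (Set.toFinite _)
    have hx : x ∉ t := fun h => lt_irrefl _ (ht h)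
    have h := Set.encard_le_chainHeight_of_isChain s (insert x t)
      (Set.insert_subset (hs x le_rfl) fun y hy => hs y (ht hy).le)
      (hchain.insert fun y hy _ => Or.inr (ht hy).le)
    rw [Set.encard_insert_of_notMem hx, htc] at h
    have h1 := Set.chainHeight_ne_top_of_finite (Set.Iio x) (fun x y => x ≤ y) (Set.toFinite _)
    have h2 := Set.chainHeight_ne_top_of_finite s (fun x y => x ≤ y) (Set.toFinite _)
    rw [← ENat.natCast_toNat h1, ← ENat.natCast_toNat h2] at h
    exact_mod_cast h
  exact ⟨fun x => ((Set.Iio x).chainHeight (fun x y => x ≤ y)).toNat,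
    fun x y hxy => key x _ fun z hz => lt_of_le_of_lt hz hxy, fun x => key x _ fun _ _ => trivial⟩

theorem exists_finset_isChain_card_eq (P : Type*) [PartialOrder P] [Finite P] :
    ∃ C : Finset P, IsChain (fun x y => x ≤ y) (C : Set P) ∧ C.card = (posetHeight P).toNat := by
  obtain ⟨t, _, htc, hchain⟩ := Set.exists_eq_chainHeight_of_finite (Set.univ : Set P)
    (fun x y => x ≤ y) Set.finite_univ
  refine ⟨t.toFinite.toFinset, by simpa using hchain, ?_⟩
  rw [posetHeight, ← htc, ← Set.ncard_def, Set.ncard_eq_toFinset_card]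

end PosetHeight

/-! ### Images of transformations -/

namespace FullTransformationMonoid

variable {n : ℕ}

/-- A self-map of `Fin n`, regarded as an element of `T_n`. -/
def ofFun (φ : Fin n → Fin n) : FullTransformationMonoid n := MulOpposite.op φ

@[simp]
theorem ofFun_apply (φ : Fin n → Fin n) (x : Fin n) : (ofFun φ).unop x = φ x := rfl

/-- The image of a transformation. -/
def im (f : FullTransformationMonoid n) : Finset (Fin n) := Finset.univ.image fun x => f.unop x

theorem mem_im {f : FullTransformationMonoid n} {y : Fin n} : y ∈ im f ↔ ∃ x, f.unop x = y := by
  simp only [im, Finset.mem_image, Finset.mem_univ, true_and]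

theorem apply_mem_im (f : FullTransformationMonoid n) (x : Fin n) : f.unop x ∈ im f :=
  mem_im.2 ⟨x, rfl⟩

@[ext]
theorem hom_ext {f g : FullTransformationMonoid n} (h : ∀ x, f.unop x = g.unop x) : f = g :=
  MulOpposite.unop_injective (funext h)

theorem im_mul_subset (a f : FullTransformationMonoid n) : im (a * f) ⊆ im f := by
  intro y hy
  obtain ⟨x, rfl⟩ := mem_im.1 hy
  exact apply_mem_im f (a.unop x)

theorem exists_im_eq {A : Finset (Fin n)} (hA : A.Nonempty) :
    ∃ f : FullTransformationMonoid n, im f = A := by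
  obtain ⟨c, hc⟩ := hA
  refine ⟨ofFun fun x => if x ∈ A then x else c, Finset.ext fun y => ?_⟩
  rw [mem_im]
  simp only [ofFun_apply]
  constructor
  · rintro ⟨x, rfl⟩
    by_cases hx : x ∈ A <;> simp [hx, hc]
  · exact fun hy => ⟨y, if_pos hy⟩

/-- Transformations with the same image generate the same principal left ideal. -/
theorem exists_mul_eq_of_im_subset {f g : FullTransformationMonoid n} (h : im f ⊆ im g) :
    ∃ a, a * g = f := by
  choose a ha using fun x => mem_im.1 (h (apply_mem_im f x))
  exact ⟨ofFun a, hom_ext ha⟩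

/-! ### Permutations of an image -/

/-- A permutation of `A`, regarded as a transformation fixing every point outside `A`. -/
def ofPerm {A : Finset (Fin n)} (h : Equiv.Perm A) : FullTransformationMonoid n :=
  ofFun fun x => (Equiv.Perm.ofSubtype h : Equiv.Perm (Fin n)) x

theorem mul_ofPerm_apply {A : Finset (Fin n)} (h : Equiv.Perm A) (f : FullTransformationMonoid n)
    (x : Fin n) :
    (f * ofPerm h).unop x = Equiv.Perm.ofSubtype h (f.unop x) := rfl

theorem mul_ofPerm_one {A : Finset (Fin n)} (f : FullTransformationMonoid n) :
    f * ofPerm (1 : Equiv.Perm A) = f :=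
  hom_ext fun x => by simp [mul_ofPerm_apply]

theorem mul_ofPerm_mul {A : Finset (Fin n)} (h k : Equiv.Perm A)
    (f : FullTransformationMonoid n) :
    f * ofPerm (h * k) = f * ofPerm k * ofPerm h :=
  hom_ext fun x => by simp [mul_ofPerm_apply]

theorem im_mul_ofPerm_subset {A : Finset (Fin n)} (h : Equiv.Perm A)
    {f : FullTransformationMonoid n} (hf : im f ⊆ A) : im (f * ofPerm h) ⊆ A := by
  intro y hy
  obtain ⟨x, rfl⟩ := mem_im.1 hy
  have hx := hf (apply_mem_im f x)
  rw [mul_ofPerm_apply, Equiv.Perm.ofSubtype_apply_of_mem h hx]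
  exact (h _).2

theorem card_im_mul_ofPerm {A : Finset (Fin n)} (h : Equiv.Perm A)
    (f : FullTransformationMonoid n) : (im (f * ofPerm h)).card = (im f).card := by
  have : im (f * ofPerm h) = (im f).image (Equiv.Perm.ofSubtype h) := by
    rw [im, im, Finset.image_image]
    rfl
  rw [this, Finset.card_image_of_injective _ (Equiv.injective _)]

theorem im_mul_ofPerm {A : Finset (Fin n)} (h : Equiv.Perm A)
    {f : FullTransformationMonoid n} (hf : im f = A) : im (f * ofPerm h) = A :=
  Finset.eq_of_subset_of_card_le (im_mul_ofPerm_subset h hf.subset)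
    (by rw [card_im_mul_ofPerm, hf])

theorem mul_ofPerm_injective {A : Finset (Fin n)} {f : FullTransformationMonoid n}
    (hf : im f = A) {h k : Equiv.Perm A} (hhk : f * ofPerm h = f * ofPerm k) : h = k := by
  ext ⟨y, hy⟩
  obtain ⟨x, rfl⟩ := mem_im.1 (hf.symm ▸ hy : y ∈ im f)
  have := congrArg (fun g : FullTransformationMonoid n => g.unop x) hhk
  simp only [mul_ofPerm_apply] at this
  rw [Equiv.Perm.ofSubtype_apply_of_mem h hy, Equiv.Perm.ofSubtype_apply_of_mem k hy] at this
  rw [this]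

/-- Two transformations with the same image `A` either differ by a permutation of `A`, or some
left multiplication fixes one of them and makes the image of the other strictly smaller. -/
theorem exists_ofPerm_or_exists_im_ssubset {A : Finset (Fin n)} {f g : FullTransformationMonoid n}
    (hf : im f = A) (hg : im g = A) :
    (∃ h : Equiv.Perm A, g = f * ofPerm h) ∨
      (∃ a, a * f = f ∧ im (a * g) ⊂ A) ∨ ∃ a, a * g = g ∧ im (a * f) ⊂ A := by
  by_cases hker : ∀ x x', f.unop x = f.unop x' → g.unop x = g.unop x'
  · left
    choose s hs using fun y : A => mem_im.1 (hf.symm ▸ y.2 : (y : Fin n) ∈ im f)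
    -- As `ker f ⊆ ker g`, the map `f x ↦ g x` is well defined on `A`; it is onto, so bijective.
    let k : A → A := fun y => ⟨g.unop (s y), hg ▸ apply_mem_im g _⟩
    have hk : ∀ x (hx : f.unop x ∈ A), (k ⟨f.unop x, hx⟩ : Fin n) = g.unop x :=
      fun x hx => hker _ _ (hs ⟨f.unop x, hx⟩)
    have hsurj : Function.Surjective k := by
      rintro ⟨y, hy⟩
      obtain ⟨x, rfl⟩ := mem_im.1 (hg.symm ▸ hy : y ∈ im g)
      exact ⟨⟨f.unop x, hf ▸ apply_mem_im f x⟩, Subtype.ext (hk x _)⟩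
    refine ⟨Equiv.ofBijective k (Finite.surjective_iff_bijective.1 hsurj), hom_ext fun x => ?_⟩
    have hx : f.unop x ∈ A := hf ▸ apply_mem_im f x
    rw [mul_ofPerm_apply, Equiv.Perm.ofSubtype_apply_of_mem _ hx]
    exact (hk x hx).symm
  · right; right
    push Not at hker
    obtain ⟨x, x', hfx, hgx⟩ := hker
    choose s hs using fun y : Fin n => fun hy : y ∈ im g => mem_im.1 hy
    -- A section `t` of `g` whose range contains both `x` and `x'`, which `f` identifies.
    let t : Fin n → Fin n := fun y =>
      if y = g.unop x then x else if y = g.unop x' then x' else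
        if hy : y ∈ im g then s y hy else y
    have ht : ∀ y ∈ im g, g.unop (t y) = y := by
      intro y hy
      by_cases h1 : y = g.unop x
      · simp [t, h1]
      by_cases h2 : y = g.unop x'
      · simp [t, h2, Ne.symm hgx]
      simp [t, h1, h2, hy, hs]
    have htx : t (g.unop x) = x := by simp [t]
    have htx' : t (g.unop x') = x' := by simp [t, Ne.symm hgx]
    refine ⟨ofFun fun z => t (g.unop z),
      hom_ext fun z => ht _ (apply_mem_im g z), ?_⟩
    have hsub : im (ofFun (fun z => t (g.unop z)) * f) ⊆ A :=
      hf ▸ im_mul_subset _ f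
    refine Finset.ssubset_iff_subset_ne.2 ⟨hsub, fun heq => hgx ?_⟩
    have himg : im (ofFun (fun z => t (g.unop z)) * f) =
        A.image fun y => f.unop (t y) := by
      rw [← hg, im, im, Finset.image_image]
      rfl
    have hinj : Set.InjOn (fun y => f.unop (t y)) A :=
      Finset.card_image_iff.1 (by rw [← himg, heq])
    exact hinj (hg ▸ apply_mem_im g x) (hg ▸ apply_mem_im g x') (by simp [htx, htx', hfx])

end FullTransformationMonoid

/-! ### The invariants of a left congruence -/

namespace LeftCongruence

open FullTransformationMonoid

variable {n : ℕ}

/-- The subgroup of all permutations `h` of `A` such that `ρ` relates `f` to `f` followed by `h`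
whenever `f` has image `A`. -/
def stab (ρ : LeftCongruence (FullTransformationMonoid n)) (A : Finset (Fin n)) :
    Subgroup (Equiv.Perm A) where
  carrier := {h | ∀ f, im f = A → ρ.toSetoid f (f * ofPerm h)}
  one_mem' f _ := by
    rw [mul_ofPerm_one]
  mul_mem' {h k} hh hk f hf := by
    rw [mul_ofPerm_mul]
    exact ρ.toSetoid.trans' (hk f hf) (hh _ (im_mul_ofPerm k hf))
  inv_mem' {h} hh f hf := by
    have := hh _ (im_mul_ofPerm h⁻¹ hf)
    rw [← mul_ofPerm_mul, mul_inv_cancel, mul_ofPerm_one] at this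
    exact ρ.toSetoid.symm' this

/-- `ρ` collapses `A` if it relates some transformation with image `A` to one whose image is
strictly smaller in the colexicographic order, a linear order extending inclusion. -/
def Collapses (ρ : LeftCongruence (FullTransformationMonoid n)) (A : Finset (Fin n)) : Prop :=
  ∃ f g, im f = A ∧ toColex (im g) < toColex A ∧ ρ.toSetoid f g

variable {ρ σ : LeftCongruence (FullTransformationMonoid n)} {A : Finset (Fin n)}

theorem stab_mono (h : ρ ≤ σ) : stab ρ A ≤ stab σ A :=
  fun _ hk f hf => h _ _ (hk f hf)

theorem Collapses.mono (h : ρ ≤ σ) : Collapses ρ A → Collapses σ A :=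
  fun ⟨f, g, hf, hg, hfg⟩ => ⟨f, g, hf, hg, h _ _ hfg⟩

/-- If `A` is collapsed, then every transformation with image `A` is related to one with an
earlier image. -/
theorem Collapses.exists_lt (h : Collapses ρ A) {f : FullTransformationMonoid n}
    (hf : im f = A) : ∃ g, toColex (im g) < toColex A ∧ ρ.toSetoid f g := by
  obtain ⟨f', g, hf', hg, hfg⟩ := h
  obtain ⟨a, rfl⟩ := exists_mul_eq_of_im_subset (hf.trans hf'.symm).subset
  exact ⟨a * g, (Finset.Colex.toColex_mono (im_mul_subset a g)).trans_lt hg, ρ.mul_left _ _ _ hfg⟩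

/-- If `A` is not collapsed, related transformations with image `A` differ by an element of the
stabiliser: a difference of kernels would collapse `A`. -/
theorem exists_mem_stab (hA : ¬ Collapses ρ A) {f g : FullTransformationMonoid n}
    (hf : im f = A) (hg : im g = A) (hfg : ρ.toSetoid f g) :
    ∃ h ∈ stab ρ A, g = f * ofPerm h := by
  rcases exists_ofPerm_or_exists_im_ssubset hf hg with ⟨h, rfl⟩ | ⟨a, ha, hlt⟩ | ⟨a, ha, hlt⟩
  · refine ⟨h, fun f' hf' => ?_, rfl⟩
    obtain ⟨a, rfl⟩ := exists_mul_eq_of_im_subset (hf'.trans hf.symm).subset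
    rw [mul_assoc]
    exact ρ.mul_left _ _ _ hfg
  · exact (hA ⟨f, a * g, hf, Finset.Colex.toColex_strictMono hlt,
      ha ▸ ρ.mul_left a _ _ hfg⟩).elim
  · exact (hA ⟨g, a * f, hg, Finset.Colex.toColex_strictMono hlt,
      ha ▸ ρ.mul_left a _ _ (ρ.toSetoid.symm' hfg)⟩).elim

/-- Comparable left congruences with the same invariants are equal. A pair related by `σ` is moved
within `ρ`-classes to images that come earlier in the colexicographic order, until the later of
the two images is not collapsed; then both images agree and the pair differs by a permutation. -/
theorem le_of_invariants (hle : ρ ≤ σ) (hcol : ∀ A, Collapses σ A → Collapses ρ A)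
    (hstab : ∀ A, ¬ Collapses σ A → stab σ A ≤ stab ρ A) : σ ≤ ρ := by
  have key : ∀ (B : Colex (Finset (Fin n))) (f g : FullTransformationMonoid n),
      toColex (im f) ≤ B → toColex (im g) ≤ B → σ.toSetoid f g → ρ.toSetoid f g := by
    intro B
    have : Finite (Colex (Finset (Fin n))) := Finite.of_equiv _ toColex
    have : WellFoundedLT (Colex (Finset (Fin n))) := Finite.to_wellFoundedLT
    induction B using (wellFounded_lt (α := Colex (Finset (Fin n)))).induction with
    | _ B ih =>
      intro f g hf hg hfg
      have below : ∀ f g : FullTransformationMonoid n, toColex (im f) < B →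
          toColex (im g) < B → σ.toSetoid f g → ρ.toSetoid f g := fun f g hf hg hfg =>
        ih _ (max_lt hf hg) f g (le_max_left _ _) (le_max_right _ _) hfg
      by_cases hB : Collapses σ (ofColex B)
      · have down : ∀ f : FullTransformationMonoid n, toColex (im f) ≤ B →
            ∃ f', toColex (im f') < B ∧ ρ.toSetoid f f' := by
          intro f hf
          rcases hf.lt_or_eq with hf | hf
          · exact ⟨f, hf, ρ.toSetoid.refl' f⟩
          · exact (hcol _ hB).exists_lt (congrArg ofColex hf)
        obtain ⟨f', hf', hff'⟩ := down f hf
        obtain ⟨g', hg', hgg'⟩ := down g hg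
        have h : σ.toSetoid f' g' := σ.toSetoid.trans' (σ.toSetoid.symm' (hle _ _ hff'))
          (σ.toSetoid.trans' hfg (hle _ _ hgg'))
        exact ρ.toSetoid.trans' hff'
          (ρ.toSetoid.trans' (below f' g' hf' hg' h) (ρ.toSetoid.symm' hgg'))
      · rcases hf.lt_or_eq with hf | hf <;> rcases hg.lt_or_eq with hg | hg
        · exact below f g hf hg hfg
        · exact (hB ⟨g, f, congrArg ofColex hg, hf, σ.toSetoid.symm' hfg⟩).elim
        · exact (hB ⟨f, g, congrArg ofColex hf, hg, hfg⟩).elim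
        · obtain ⟨h, hh, rfl⟩ := exists_mem_stab hB (congrArg ofColex hf) (congrArg ofColex hg) hfg
          exact hstab _ hB hh f (congrArg ofColex hf)
  exact fun f g hfg => key _ f g (le_max_left _ _) (le_max_right _ _) hfg

/-! ### The upper bound -/

/-- The nonempty subsets of `Fin n` other than `{0}`, the colexicographically least one. -/
def largeSubsets (n : ℕ) [NeZero n] : Finset (Finset (Fin n)) :=
  Finset.univ.filter fun A => A.Nonempty ∧ A ≠ {0}

theorem im_nonempty [NeZero n] (f : FullTransformationMonoid n) : (im f).Nonempty :=
  ⟨_, apply_mem_im f 0⟩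

theorem not_collapses_singleton_zero [NeZero n] : ¬ Collapses ρ {0} := by
  rintro ⟨f, g, _, hg, _⟩
  rw [Finset.Colex.toColex_lt_singleton] at hg
  exact Fin.not_lt_zero _ (hg _ (apply_mem_im g 0))

/-- The sum of the heights of the subgroup lattices of the symmetric groups on the subsets in
`largeSubsets n`. -/
noncomputable def totalHeight (n : ℕ) [NeZero n] : ℕ :=
  ∑ A ∈ largeSubsets n, (posetHeight (Subgroup (Equiv.Perm A))).toNat

theorem posetHeight_le (n : ℕ) [NeZero n] :
    posetHeight (LeftCongruence (FullTransformationMonoid n)) ≤ totalHeight n + 1 := by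
  classical
  choose d hd hdlt using fun A : Finset (Fin n) =>
    exists_strictMono_lt_posetHeight (Subgroup (Equiv.Perm A))
  -- The contribution of `A` never exceeds the height for `A`, and reaches it only by collapse.
  let φ : LeftCongruence (FullTransformationMonoid n) → Finset (Fin n) → ℕ := fun ρ A =>
    if Collapses ρ A then (posetHeight (Subgroup (Equiv.Perm A))).toNat else d A (stab ρ A)
  have hφle : ∀ ρ A, φ ρ A ≤ (posetHeight (Subgroup (Equiv.Perm A))).toNat := by
    intro ρ A
    by_cases h : Collapses ρ A
    · simp [φ, h]
    · simpa [φ, h] using (hdlt A _).le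
  have hφmono : ∀ A {ρ σ}, ρ ≤ σ → φ ρ A ≤ φ σ A := by
    intro A ρ σ hle
    by_cases hσ : Collapses σ A
    · simpa [φ, hσ] using hφle ρ A
    · have hρ : ¬ Collapses ρ A := fun h => hσ (h.mono hle)
      simpa [φ, hσ, hρ] using (hd A).monotone (stab_mono hle)
  refine posetHeight_le_of_strictMono (φ := fun ρ => ∑ A ∈ largeSubsets n, φ ρ A) ?_
    fun ρ => Finset.sum_le_sum fun A _ => hφle ρ A
  intro ρ σ hlt
  refine lt_of_le_of_ne (Finset.sum_le_sum fun A _ => hφmono A hlt.le) fun heq => ?_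
  have hA : ∀ A ∈ largeSubsets n, φ ρ A = φ σ A :=
    (Finset.sum_eq_sum_iff_of_le fun A _ => hφmono A hlt.le).1 heq
  refine hlt.not_ge (le_of_invariants hlt.le (fun A hσ => ?_) fun A hσ => ?_)
  · by_contra hρ
    have hmem : A ∈ largeSubsets n := by
      refine Finset.mem_filter.2 ⟨Finset.mem_univ _, ?_, ?_⟩
      · obtain ⟨f, _, rfl, _⟩ := hσ
        exact im_nonempty f
      · rintro rfl
        exact not_collapses_singleton_zero hσ
    have := hA A hmem
    simp only [φ, hσ, hρ, if_true, if_false] at this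
    exact (hdlt A _).ne this
  · have hρ : ¬ Collapses ρ A := fun h => hσ (h.mono hlt.le)
    by_cases hmem : A ∈ largeSubsets n
    · have := hA A hmem
      simp only [φ, hσ, hρ, if_false] at this
      have hle := stab_mono (A := A) hlt.le
      rcases hle.lt_or_eq with h | h
      · exact ((hd A h).ne this).elim
      · exact h.ge
    · -- The excluded subsets `∅` and `{0}` have only the trivial permutation.
      have hsub : Subsingleton A := by
        by_cases hne : A.Nonempty
        · have : A = {0} := by simpa [largeSubsets, hne] using hmem
          subst this
          exact ⟨fun x y => Subtype.ext (by
            rw [Finset.mem_singleton.1 x.2, Finset.mem_singleton.1 y.2])⟩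
        · exact ⟨fun x => (hne ⟨_, x.2⟩).elim⟩
      intro h _
      rw [Subsingleton.elim h 1]
      exact one_mem _

/-! ### The lower bound -/

/-- The left congruence that identifies all transformations whose images precede `A` in the
colexicographic order, and identifies transformations with image `A` that differ by an element
of the subgroup `H`. -/
def layer (A : Finset (Fin n)) (H : Subgroup (Equiv.Perm A)) :
    LeftCongruence (FullTransformationMonoid n) where
  r f g := (toColex (im f) < toColex A ∧ toColex (im g) < toColex A) ∨ f = g ∨
    (im f = A ∧ ∃ h ∈ H, g = f * ofPerm h)
  iseqv :=
    { refl := fun f => Or.inr (Or.inl rfl)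
      symm := by
        rintro f g (⟨hf, hg⟩ | rfl | ⟨hf, h, hh, rfl⟩)
        · exact Or.inl ⟨hg, hf⟩
        · exact Or.inr (Or.inl rfl)
        · refine Or.inr (Or.inr ⟨im_mul_ofPerm h hf, h⁻¹, inv_mem hh, ?_⟩)
          rw [← mul_ofPerm_mul, inv_mul_cancel, mul_ofPerm_one]
      trans := by
        rintro f g k (⟨hf, hg⟩ | rfl | ⟨hf, h, hh, rfl⟩) h2
        · rcases h2 with ⟨_, hk⟩ | rfl | ⟨hg', _⟩
          · exact Or.inl ⟨hf, hk⟩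
          · exact Or.inl ⟨hf, hg⟩
          · exact (lt_irrefl _ (hg' ▸ hg)).elim
        · exact h2
        · rcases h2 with ⟨hg, _⟩ | rfl | ⟨_, h', hh', rfl⟩
          · rw [im_mul_ofPerm h hf] at hg
            exact (lt_irrefl _ hg).elim
          · exact Or.inr (Or.inr ⟨hf, h, hh, rfl⟩)
          · exact Or.inr (Or.inr ⟨hf, h' * h, mul_mem hh' hh, (mul_ofPerm_mul h' h f).symm⟩) }
  mul_left := by
    rintro a f g (⟨hf, hg⟩ | rfl | ⟨hf, h, hh, rfl⟩)
    · exact Or.inl ⟨(Finset.Colex.toColex_mono (im_mul_subset a f)).trans_lt hf,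
        (Finset.Colex.toColex_mono (im_mul_subset a g)).trans_lt hg⟩
    · exact Or.inr (Or.inl rfl)
    · have hsub : im (a * f) ⊆ A := hf ▸ im_mul_subset a f
      by_cases haf : im (a * f) = A
      · exact Or.inr (Or.inr ⟨haf, h, hh, (mul_assoc a f _).symm⟩)
      · have hss : im (a * f) ⊂ A := Finset.ssubset_iff_subset_ne.2 ⟨hsub, haf⟩
        have hss' : im (a * (f * ofPerm h)) ⊂ A := by
          rw [← mul_assoc]
          refine Finset.ssubset_iff_subset_ne.2 ⟨im_mul_ofPerm_subset h hsub, fun heq => ?_⟩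
          have h1 := card_im_mul_ofPerm h (a * f)
          rw [heq] at h1
          exact (Finset.card_lt_card hss).ne' h1
        exact Or.inl ⟨Finset.Colex.toColex_strictMono hss, Finset.Colex.toColex_strictMono hss'⟩

theorem layer_apply {H : Subgroup (Equiv.Perm A)} {f g : FullTransformationMonoid n} :
    (layer A H).toSetoid f g ↔
      (toColex (im f) < toColex A ∧ toColex (im g) < toColex A) ∨ f = g ∨
        (im f = A ∧ ∃ h ∈ H, g = f * ofPerm h) := Iff.rfl

theorem layer_le_layer_iff (hA : A.Nonempty) {H K : Subgroup (Equiv.Perm A)} :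
    layer A H ≤ layer A K ↔ H ≤ K := by
  constructor
  · intro hle h hh
    obtain ⟨f, hf⟩ := exists_im_eq hA
    have := hle f (f * ofPerm h) (layer_apply.2 (Or.inr (Or.inr ⟨hf, h, hh, rfl⟩)))
    rcases layer_apply.1 this with ⟨hlt, _⟩ | heq | ⟨_, k, hk, heq⟩
    · exact (lt_irrefl _ (hf ▸ hlt)).elim
    · rw [← mul_ofPerm_injective hf ((mul_ofPerm_one f).trans heq)]
      exact one_mem K
    · rwa [mul_ofPerm_injective hf heq]
  · rintro hle f g (hlt | heq | ⟨hf, h, hh, rfl⟩)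
    · exact Or.inl hlt
    · exact Or.inr (Or.inl heq)
    · exact Or.inr (Or.inr ⟨hf, h, hle hh, rfl⟩)

theorem layer_le_layer_of_lt {B : Finset (Fin n)} (hAB : toColex A < toColex B)
    (H : Subgroup (Equiv.Perm A)) (K : Subgroup (Equiv.Perm B)) : layer A H ≤ layer B K := by
  rintro f g (⟨hf, hg⟩ | heq | ⟨hf, h, hh, rfl⟩)
  · exact Or.inl ⟨hf.trans hAB, hg.trans hAB⟩
  · exact Or.inr (Or.inl heq)
  · exact Or.inl ⟨hf ▸ hAB, (im_mul_ofPerm h hf).symm ▸ hAB⟩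

theorem singleton_zero_lt [NeZero n] (hA : A ∈ largeSubsets n) :
    toColex ({0} : Finset (Fin n)) < toColex A := by
  obtain ⟨_, ⟨x, hx⟩, hne⟩ := Finset.mem_filter.1 hA
  refine lt_of_le_of_ne (Finset.Colex.singleton_le_toColex.2 ⟨x, hx, Fin.zero_le x⟩) ?_
  exact fun h => hne (toColex_inj.1 h).symm

theorem not_layer_of_lt {H : Subgroup (Equiv.Perm A)} {f g : FullTransformationMonoid n}
    (hf : im f = A) (hg : toColex (im g) < toColex A) : ¬ (layer A H).toSetoid f g := by
  rintro (⟨hlt, _⟩ | rfl | ⟨_, h, _, rfl⟩)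
  · exact lt_irrefl _ (hf ▸ hlt)
  · exact lt_irrefl _ (hf ▸ hg)
  · rw [im_mul_ofPerm h hf] at hg
    exact lt_irrefl _ hg

theorem layer_lt_layer_of_lt [NeZero n] {B : Finset (Fin n)} (hA : A ∈ largeSubsets n)
    (hAB : toColex A < toColex B)
    (H : Subgroup (Equiv.Perm A)) (K : Subgroup (Equiv.Perm B)) : layer A H < layer B K := by
  obtain ⟨f, hf⟩ := exists_im_eq (Finset.mem_filter.1 hA).2.1
  obtain ⟨g, hg⟩ := exists_im_eq (Finset.singleton_nonempty (0 : Fin n))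
  have hgA : toColex (im g) < toColex A := hg ▸ singleton_zero_lt hA
  refine lt_of_le_of_ne (layer_le_layer_of_lt hAB H K) fun heq => not_layer_of_lt hf hgA (H := H) ?_
  rw [heq]
  exact Or.inl ⟨hf ▸ hAB, hgA.trans hAB⟩

theorem layer_ne_top [NeZero n] (hA : A ∈ largeSubsets n) (H : Subgroup (Equiv.Perm A)) :
    layer A H ≠ ⊤ := by
  obtain ⟨f, hf⟩ := exists_im_eq (Finset.mem_filter.1 hA).2.1
  obtain ⟨g, hg⟩ := exists_im_eq (Finset.singleton_nonempty (0 : Fin n))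
  intro heq
  refine not_layer_of_lt hf (hg ▸ singleton_zero_lt hA : toColex (im g) < _) (H := H) ?_
  -- The top element is the universal relation, as it lies above the universal relation `τ`.
  let τ : LeftCongruence (FullTransformationMonoid n) := { toSetoid := ⊤, mul_left := by simp }
  have hτ : τ ≤ layer A H := heq ▸ le_top
  exact hτ f g trivial

theorem le_posetHeight (n : ℕ) [NeZero n] :
    totalHeight n + 1 ≤ posetHeight (LeftCongruence (FullTransformationMonoid n)) := by
  classical
  choose C hC hcard using fun A : Finset (Fin n) =>
    exists_finset_isChain_card_eq (Subgroup (Equiv.Perm A))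
  let S : Finset (Σ A : Finset (Fin n), Subgroup (Equiv.Perm A)) := (largeSubsets n).sigma C
  let Ψ : (Σ A : Finset (Fin n), Subgroup (Equiv.Perm A)) →
    LeftCongruence (FullTransformationMonoid n) := fun p => layer p.1 p.2
  have htotal : ∀ p ∈ S, ∀ q ∈ S, p ≠ q → Ψ p < Ψ q ∨ Ψ q < Ψ p := by
    rintro ⟨A, H⟩ hp ⟨B, K⟩ hq hne
    obtain ⟨hA, hH⟩ := Finset.mem_sigma.1 hp
    obtain ⟨hB, hK⟩ := Finset.mem_sigma.1 hq
    rcases lt_trichotomy (toColex A) (toColex B) with h | h | h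
    · exact Or.inl (layer_lt_layer_of_lt hA h H K)
    · obtain rfl := toColex_inj.1 h
      have hHK : H ≠ K := fun h => hne (by rw [h])
      have hne' := (Finset.mem_filter.1 hA).2.1
      have hlt : ∀ {H K : Subgroup (Equiv.Perm A)}, H ≤ K → H ≠ K → layer A H < layer A K :=
        fun hle hne => lt_of_le_not_ge ((layer_le_layer_iff hne').2 hle)
          fun h => hne (hle.antisymm ((layer_le_layer_iff hne').1 h))
      rcases hC A hH hK hHK with hle | hle
      · exact Or.inl (hlt hle hHK)
      · exact Or.inr (hlt hle hHK.symm)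
    · exact Or.inr (layer_lt_layer_of_lt hB h K H)
  have hinj : Set.InjOn Ψ S := by
    intro p hp q hq heq
    by_contra hne
    rcases htotal p hp q hq hne with h | h
    · exact h.ne heq
    · exact h.ne' heq
  have htop : (⊤ : LeftCongruence (FullTransformationMonoid n)) ∉ Ψ '' S := by
    rintro ⟨p, hp, heq⟩
    exact layer_ne_top (Finset.mem_sigma.1 hp).1 p.2 heq
  have hchain : IsChain (fun ρ σ => ρ ≤ σ) (insert ⊤ (Ψ '' S)) := by
    refine IsChain.insert ?_ fun σ _ _ => Or.inr le_top
    rintro _ ⟨p, hp, rfl⟩ _ ⟨q, hq, rfl⟩ hne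
    rcases htotal p hp q hq fun h => hne (by rw [h]) with h | h
    · exact Or.inl h.le
    · exact Or.inr h.le
  have h := Set.encard_le_chainHeight_of_isChain Set.univ _ (Set.subset_univ _) hchain
  rw [Set.encard_insert_of_notMem htop, hinj.encard_image, Set.encard_coe_eq_coe_finsetCard,
    Finset.card_sigma] at h
  simp only [hcard] at h
  exact h

end LeftCongruence

/-! ### Summation over subsets by cardinality -/

theorem posetHeight_subgroup_perm {n : ℕ} (A : Finset (Fin n)) :
    posetHeight (Subgroup (Equiv.Perm A)) = posetHeight (Subgroup (Equiv.Perm (Fin A.card))) :=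
  posetHeight_congr A.equivFin.permCongrHom.mapSubgroup

/-- The summand `1` is the height of the subgroup lattice of the symmetric group on `{0}`. -/
theorem LeftCongruence.totalHeight_add_one (n : ℕ) [NeZero n] :
    totalHeight n + 1 = ∑ r ∈ Finset.Icc 1 n,
      n.choose r * (posetHeight (Subgroup (Equiv.Perm (Fin r)))).toNat := by
  set F : ℕ → ℕ := fun r => (posetHeight (Subgroup (Equiv.Perm (Fin r)))).toNat with hF
  have hF1 : F 1 = 1 := by
    have : posetHeight (Subgroup (Equiv.Perm (Fin 1))) = 1 := posetHeight_of_unique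
    simp [hF, this]
  have hsum := Finset.sum_powerset_apply_card F (x := (Finset.univ : Finset (Fin n)))
  rw [Finset.card_univ, Fintype.card_fin, Finset.powerset_univ, Finset.sum_range_succ',
    ← Finset.add_sum_erase _ _ (Finset.mem_univ (∅ : Finset (Fin n))),
    ← Finset.add_sum_erase _ _ (show ({0} : Finset (Fin n)) ∈ Finset.univ.erase ∅ by simp)] at hsum
  have hlarge : (Finset.univ.erase (∅ : Finset (Fin n))).erase {0} = largeSubsets n := by
    ext A
    simp [largeSubsets, Finset.nonempty_iff_ne_empty, and_comm]
  rw [hlarge] at hsum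
  have htot : totalHeight n = ∑ A ∈ largeSubsets n, F A.card :=
    Finset.sum_congr rfl fun A _ => by rw [posetHeight_subgroup_perm]
  have hIcc : ∑ r ∈ Finset.Icc 1 n, n.choose r * F r =
      ∑ k ∈ Finset.range n, n.choose (k + 1) * F (k + 1) := by
    rw [Finset.range_eq_Ico, Finset.sum_Ico_add' (fun k => n.choose k * F k) 0 n 1]
    rfl
  rw [hIcc, htot]
  simp only [Finset.card_empty, Finset.card_singleton, hF1, Nat.choose_zero_right, smul_eq_mul,
    one_mul] at hsum
  omega

theorem mainTheorem1 (n : ℕ) (hn : 1 ≤ n) :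
    posetHeight (LeftCongruence (FullTransformationMonoid n)) =
      ∑ r ∈ Finset.Icc 1 n,
        (n.choose r : ℕ∞) * posetHeight (Subgroup (Equiv.Perm (Fin r))) := by
  have : NeZero n := ⟨by omega⟩
  rw [le_antisymm (LeftCongruence.posetHeight_le n) (LeftCongruence.le_posetHeight n)]
  have h := congrArg (Nat.cast : ℕ → ℕ∞) (LeftCongruence.totalHeight_add_one n)
  push_cast at h
  simpa only [coe_toNat_posetHeight] using h
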